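/- Write elements of $\mathbb{Z}^2$ additively and let $A=\{0,1,\dots,35\}$ be discrete. Equip $A^{\mathbb{Z}^2}$ with the product topology and with the left shift action $(sx)_t=x_{-s+t}$ of $\mathbb{Z}^2$. A subshift is a closed shift-invariant subset of $A^{\mathbb{Z}^2}$; the set of all subshifts carries the Vietoris topology and its Borel $\sigma$-algebra. A function $x:\mathbb{Z}^2\to A$ is Toeplitz if it is continuous for the profinite topology on $\mathbb{Z}^2$ (the topology generated by all cosets of finite index subgroups), and a subshift is Toeplitz if it is the closure of the $\mathbb{Z}^2$-orbit of some Toeplitz function. A subshift is free if each of its points has trivial stabilizer. The topological full group $[[\mathbb{Z}^2\curvearrowright X]]$ of a subshift $X$ is the group of all homeomorphisms $T:X\to X$ for which there are a clopen partition $\{A_1,\dots,A_k\}$ of $X$ and $s_1,\dots,s_k\in\mathbb{Z}^2$ such that $Tx=s_ix$ for all $i$ and all $x\in A_i$. A discrete group $G$ is amenable if there is a left-invariant finitely additive probability measure defined on all subsets of $G$. Two subshifts $X$ and $Y$ are topologically conjugate if there is a $\mathbb{Z}^2$-equivariant homeomorphism $X\to Y$. An equivalence relation $E$ on a set $Z$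 equipped with a $\sigma$-algebra is smooth if there are a standard Borel space $W$ and a measurable map $\varphi:Z\to W$ such that, for all $x_1,x_2\in Z$, one has $x_1\,E\,x_2$ if and only if $\varphi(x_1)=\varphi(x_2)$. Theorem. Let $\mathrm{NAToepSubsh}(36^{\mathbb{Z}^2})$ be the set of all free Toeplitz subshifts $X$ of $A^{\mathbb{Z}^2}$ whose topological full group $[[\mathbb{Z}^2\curvearrowright X]]$ is nonamenable, with the Borel structure inherited from the space of all subshifts. Then the relation of topological conjugacy on $\mathrm{NAToepSubsh}(36^{\mathbb{Z}^2})$ is not smooth. -/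

import Mathlib

open Set Topology SymbolicDynamics.FullShift

noncomputable section

/-! ### Smooth equivalence relations -/

/-- An equivalence relation `E` on a Borel space `X` is smooth if there are a standard Borel space
`Y` and a Borel map `φ : X → Y` with `x₁ E x₂ ↔ φ x₁ = φ x₂`.  Every standard Borel space is Borel
isomorphic to one living in `Type`, so there is no loss in taking `Y : Type`. -/
def IsSmooth {X : Type*} [MeasurableSpace X] (E : Setoid X) : Prop :=
  ∃ (Y : Type) (_ : MeasurableSpace Y) (_ : StandardBorelSpace Y) (φ : X → Y),
    Measurable φ ∧ ∀ x₁ x₂ : X, E x₁ x₂ ↔ φ x₁ = φ x₂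

/-! ### Amenability of discrete groups -/

/-- A mean on a set: a finitely additive probability measure defined on all subsets. -/
structure Mean (S : Type*) where
  toFun : Set S → ℝ
  nonneg : ∀ A, 0 ≤ toFun A
  univ : toFun Set.univ = 1
  union : ∀ A B, Disjoint A B → toFun (A ∪ B) = toFun A + toFun B

/-- A discrete group is amenable if it has a mean that is invariant under left translation. -/
def IsAmenableGroup (G : Type*) [Group G] : Prop :=
  ∃ m : Mean G, ∀ (g : G) (A : Set G), m.toFun ((fun h => g * h) '' A) = m.toFun A

/-! ### The topological full group -/

section TopologicalFullGroup

variable (Γ : Type*) [AddGroup Γ] (X : Type*) [TopologicalSpace X] [AddAction Γ X]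

/-- `T` acts on each piece of some finite clopen partition by an element of `Γ`. -/
def IsPiecewiseTranslation (T : X ≃ₜ X) : Prop :=
  ∃ (k : ℕ) (A : Fin k → Set X) (s : Fin k → Γ),
    (∀ i, IsClopen (A i)) ∧ Pairwise (fun i j => Disjoint (A i) (A j)) ∧ (⋃ i, A i) = Set.univ ∧
      ∀ i, ∀ x ∈ A i, T x = s i +ᵥ x

variable {Γ X}

theorem isPiecewiseTranslation_iff (T : X ≃ₜ X) :
    IsPiecewiseTranslation Γ X T ↔
      ∃ κ : X → Γ, IsLocallyConstant κ ∧ (Set.range κ).Finite ∧ ∀ x, T x = κ x +ᵥ x := by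
  constructor
  · rintro ⟨k, A, s, hA, hd, hu, hT⟩
    have hmem : ∀ x, ∃ i, x ∈ A i := fun x => by
      have : x ∈ ⋃ i, A i := hu ▸ Set.mem_univ x
      simpa using this
    choose i hi using hmem
    have huniq : ∀ x j, x ∈ A j → i x = j := fun x j hj => by
      by_contra hne
      exact Set.disjoint_left.1 (hd hne) (hi x) hj
    refine ⟨fun x => s (i x), ?_, ?_, fun x => hT _ _ (hi x)⟩
    · rw [IsLocallyConstant.iff_exists_open]
      intro x
      exact ⟨A (i x), (hA _).isOpen, hi x, fun y hy => by rw [huniq y _ hy]⟩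
    · exact (Set.finite_range s).subset (by rintro _ ⟨x, rfl⟩; exact ⟨i x, rfl⟩)
  · rintro ⟨κ, hκ, hf, hT⟩
    have : Finite (Set.range κ) := hf
    obtain ⟨k, ⟨e⟩⟩ := Finite.exists_equiv_fin (Set.range κ)
    refine ⟨k, fun i => κ ⁻¹' {(e.symm i : Γ)}, fun i => (e.symm i : Γ), ?_, ?_, ?_, ?_⟩
    · exact fun i => ⟨hκ.isClosed_fiber _, hκ.isOpen_fiber _⟩
    · intro i j hij
      refine Set.disjoint_left.2 fun x hx hy => hij ?_
      have h1 : κ x = (e.symm i : Γ) := hx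
      have h2 : κ x = (e.symm j : Γ) := hy
      exact e.symm.injective (Subtype.ext (h1.symm.trans h2))
    · refine Set.eq_univ_of_forall fun x => Set.mem_iUnion.2 ⟨e ⟨κ x, x, rfl⟩, ?_⟩
      simp
    · intro i x hx
      have h1 : κ x = (e.symm i : Γ) := hx
      rw [hT x, h1]

variable (Γ X)

/-- The topological full group `[[Γ ↷ X]]`: all homeomorphisms of `X` that act on each piece of
some finite clopen partition of `X` by an element of `Γ`, under composition. -/
def topologicalFullGroup : Subgroup (X ≃ₜ X) where
  carrier := {T | IsPiecewiseTranslation Γ X T}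
  one_mem' := by
    rw [Set.mem_ofPred_eq, isPiecewiseTranslation_iff]
    refine ⟨fun _ => 0, IsLocallyConstant.const 0, ?_, fun x => by simp⟩
    exact (Set.finite_singleton (0 : Γ)).subset (by rintro _ ⟨x, rfl⟩; rfl)
  mul_mem' := by
    intro S T hS hT
    rw [Set.mem_ofPred_eq, isPiecewiseTranslation_iff] at hS hT ⊢
    obtain ⟨κ, hκ, hκf, hS⟩ := hS
    obtain ⟨μ, hμ, hμf, hT⟩ := hT
    refine ⟨fun x => κ (T x) + μ x, ?_, ?_, fun x => ?_⟩
    · exact (hκ.comp_continuous T.continuous).add hμ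
    · refine (hκf.add hμf).subset ?_
      rintro _ ⟨x, rfl⟩
      exact Set.add_mem_add ⟨_, rfl⟩ ⟨_, rfl⟩
    · rw [add_vadd, ← hT x, ← hS (T x)]
      rfl
  inv_mem' := by
    intro T hT
    rw [Set.mem_ofPred_eq, isPiecewiseTranslation_iff] at hT ⊢
    obtain ⟨κ, hκ, hκf, hT⟩ := hT
    refine ⟨fun x => -κ (T.symm x), ?_, ?_, fun x => ?_⟩
    · exact (hκ.comp_continuous T.symm.continuous).neg
    · refine (hκf.image Neg.neg).subset ?_
      rintro _ ⟨x, rfl⟩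
      exact ⟨_, ⟨_, rfl⟩, rfl⟩
    · have h := hT (T.symm x)
      rw [T.apply_symm_apply] at h
      change T.symm x = _
      rw [eq_neg_vadd_iff]
      exact h.symm

end TopologicalFullGroup

/-! ### Subshifts -/

section Subshift

variable {Γ : Type*} [AddGroup Γ] {A : Type*}

/-- The left shift action `(s x) t = x (-s + t)` of `Γ` on `A ^ Γ`. -/
def leftShift (s : Γ) (x : Γ → A) : Γ → A := fun t => x (-s + t)

/-- The profinite topology of `Γ`: the topology generated by all cosets of finite index
subgroups. -/
abbrev profiniteTopology (Γ : Type*) [AddGroup Γ] : TopologicalSpace Γ :=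
  TopologicalSpace.generateFrom
    {C | ∃ H : AddSubgroup Γ, H.FiniteIndex ∧ ∃ g : Γ, C = (fun h => g + h) '' (H : Set Γ)}

variable [TopologicalSpace A]

/-- `x : Γ → A` is Toeplitz if it is continuous for the profinite topology of `Γ`. -/
def IsToeplitzFunction (x : Γ → A) : Prop :=
  Continuous[profiniteTopology Γ, inferInstance] x

/-- The left shift action of `Γ` on the points of a subshift. -/
instance subshiftAction (X : Subshift A Γ) : AddAction Γ X.carrier where
  vadd s x := ⟨leftShift s x.1, X.mapsTo (-s) x.2⟩
  zero_vadd x := Subtype.ext (funext fun t => by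
    change x.1 (-0 + t) = x.1 t
    simp)
  add_vadd s r x := Subtype.ext (funext fun t => by
    change x.1 (-(s + r) + t) = x.1 (-r + (-s + t))
    rw [neg_add_rev, add_assoc])

/-- The space of subshifts carries the Vietoris topology. -/
instance subshiftTopology : TopologicalSpace (Subshift A Γ) :=
  TopologicalSpace.induced Subshift.carrier (TopologicalSpace.vietoris (Γ → A))

instance subshiftBorel : MeasurableSpace (Subshift A Γ) := borel _

/-- Every point has trivial stabilizer. -/
def IsFreeSubshift (X : Subshift A Γ) : Prop :=
  ∀ (s : Γ) (x : X.carrier), s +ᵥ x = x → s = 0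

/-- The closure of the orbit of a Toeplitz function. -/
def IsToeplitzSubshift (X : Subshift A Γ) : Prop :=
  ∃ x : Γ → A, IsToeplitzFunction x ∧ X.carrier = closure (Set.range fun s : Γ => leftShift s x)

variable (Γ A)

/-- Topological conjugacy of subshifts: there is an equivariant homeomorphism. -/
def topologicalConjugacy : Setoid (Subshift A Γ) where
  r X Y := ∃ φ : X.carrier ≃ₜ Y.carrier, ∀ (s : Γ) (x : X.carrier), φ (s +ᵥ x) = s +ᵥ φ x
  iseqv :=
    { refl := fun X => ⟨Homeomorph.refl _, fun _ _ => rfl⟩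
      symm := by
        rintro X Y ⟨φ, h⟩
        refine ⟨φ.symm, fun s y => ?_⟩
        rw [φ.symm_apply_eq, h, φ.apply_symm_apply]
      trans := by
        rintro X Y Z ⟨φ, h⟩ ⟨ψ, k⟩
        exact ⟨φ.trans ψ, fun s x => by simp [h, k]⟩ }

/-- The set of free Toeplitz subshifts of `A ^ Γ` whose topological full group is nonamenable. -/
def NAToepSubsh : Set (Subshift A Γ) :=
  {X | IsFreeSubshift X ∧ IsToeplitzSubshift X ∧
    ¬ IsAmenableGroup (topologicalFullGroup Γ X.carrier)}

end Subshift

end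

/-! ### Groups generated by involutions -/

section Involutions

variable {ι G : Type*} [Group G] {a : ι → G}

/-! A binary sequence `z` is encoded in a Toeplitz configuration whose row `j` has level `ruler j`,
the 2-adic valuation of `3 * j + 1`. A row of level `n` repeats periodically the `n`-th reduced word
in three letters and carries the bit `z n`; the parity of `ruler` is recorded for both coordinates.
Every level is finite and every level occurs.

The parities locally determine both coordinates modulo every power of two
(`locallyDetermines_intCast`), which forces freeness. The letters properly color the horizontal
edges, so each gives an involution in the topological full group. Every reduced word is written
along some row, and its product moves a point there; the three involutions therefore generate a free
product, and the group is nonamenable (`not_isAmenableGroup_topologicalFullGroup`).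

Levels up to a given bound are locally recognizable, so changing finitely many bits is a block code
with a block code inverse, and the subshift stays in its conjugacy class. Yet `z` can be recovered
from the subshift, and conjugacy classes are countable because block codes are. A Borel invariant
would be almost surely constant on fair coin sequences by the zero-one law, so a countable set of
sequences would have full measure. -/

theorem prod_map_reverse_of_involutions (ha : ∀ i, a i * a i = 1) (l : List ι) :
    (l.reverse.map a).prod = (l.map a).prod⁻¹ := by
  induction l with
  | nil => simp
  | cons i t ih =>
    have : (a i)⁻¹ = a i := inv_eq_of_mul_eq_one_left (ha i)
    rw [List.reverse_cons, List.map_append, List.prod_append, ih]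
    simp [this]

/-- A common first letter cancels. If the first letters differ, the reverse of one word followed by
the other is a nonempty reduced word with product `1`. -/
theorem reducedWord_unique (ha : ∀ i, a i * a i = 1)
    (hfree : ∀ l : List ι, l.IsChain (· ≠ ·) → l ≠ [] → (l.map a).prod ≠ 1) :
    ∀ l l' : List ι, l.IsChain (· ≠ ·) → l'.IsChain (· ≠ ·) →
      (l.map a).prod = (l'.map a).prod → l = l' := by
  intro l
  induction l with
  | nil =>
    intro l' _ hl' h
    by_contra hne
    exact hfree l' hl' (Ne.symm hne) (by simpa using h.symm)
  | cons i t ih =>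
    intro l' hl hl' h
    cases l' with
    | nil => exact absurd (by simpa using h) (hfree _ hl (by simp))
    | cons j t' =>
      by_cases hij : i = j
      · subst hij
        rw [ih t' hl.tail hl'.tail (by simpa using h)]
      · refine absurd ?_ (hfree ((i :: t).reverse ++ (j :: t')) ?_ (by simp))
        · rw [List.map_append, List.prod_append, prod_map_reverse_of_involutions ha, h,
            inv_mul_cancel]
        · rw [List.isChain_append]
          refine ⟨List.isChain_reverse.2 (hl.imp fun _ _ h => h.symm), hl', ?_⟩
          simpa using hij

theorem exists_reducedWord_of_mem_closure (ha : ∀ i, a i * a i = 1) {h : G}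
    (hh : h ∈ Subgroup.closure (range a)) :
    ∃ l : List ι, l.IsChain (· ≠ ·) ∧ (l.map a).prod = h := by
  classical
  have key : ∀ i (l : List ι), l.IsChain (· ≠ ·) →
      ∃ l' : List ι, l'.IsChain (· ≠ ·) ∧ (l'.map a).prod = a i * (l.map a).prod := by
    intro i l hl
    cases l with
    | nil => exact ⟨[i], by simp, by simp⟩
    | cons j t =>
      by_cases hij : i = j
      · subst hij
        exact ⟨t, hl.tail, by simp [← mul_assoc, ha]⟩
      · exact ⟨i :: j :: t, List.isChain_cons_cons.2 ⟨hij, hl⟩, by simp⟩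
  induction hh using Subgroup.closure_induction_left with
  | one => exact ⟨[], by simp, by simp⟩
  | mul_left x hx y _ ih =>
    obtain ⟨i, rfl⟩ := hx
    obtain ⟨l, hl, rfl⟩ := ih
    exact key i l hl
  | inv_mul_cancel x hx y _ ih =>
    obtain ⟨i, rfl⟩ := hx
    obtain ⟨l, hl, rfl⟩ := ih
    rw [inv_eq_of_mul_eq_one_left (ha i)]
    exact key i l hl

theorem Mean.mono {S : Type*} (m : Mean S) {A B : Set S} (h : A ⊆ B) :
    m.toFun A ≤ m.toFun B := by
  have := m.union A (B \ A) disjoint_sdiff_right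
  rw [union_sdiff_cancel h] at this
  linarith [m.nonneg (B \ A)]

theorem Mean.union_le {S : Type*} (m : Mean S) (A B : Set S) :
    m.toFun (A ∪ B) ≤ m.toFun A + m.toFun B := by
  rw [← union_sdiff_self, m.union _ _ disjoint_sdiff_right]
  linarith [m.mono (sdiff_subset : B \ A ⊆ B)]

/-- A group containing a free product of three groups of order two is nonamenable. -/
theorem not_isAmenableGroup_of_involutions {a : Fin 3 → G} (ha : ∀ i, a i * a i = 1)
    (hfree : ∀ l : List (Fin 3), l.IsChain (· ≠ ·) → l ≠ [] → (l.map a).prod ≠ 1) :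
    ¬ IsAmenableGroup G := by
  rintro ⟨m, hm⟩
  let H : Subgroup G := Subgroup.closure (range a)
  -- The word `w g` chosen below expresses `g` relative to a fixed representative of its right coset
  -- `H g`; left multiplication by a generator keeps the representative.
  let rep : G → G := fun g => (Quotient.mk (QuotientGroup.rightRel H) g).out
  have hrep : ∀ g, ∃ l : List (Fin 3), l.IsChain (· ≠ ·) ∧ (l.map a).prod = g * (rep g)⁻¹ := by
    intro g
    refine exists_reducedWord_of_mem_closure ha ?_
    have : (QuotientGroup.rightRel H) (rep g) g := Quotient.mk_out (s := QuotientGroup.rightRel H) g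
    rwa [QuotientGroup.rightRel_apply] at this
  have hrep_mul : ∀ i g, rep (a i * g) = rep g := by
    intro i g
    have : Quotient.mk (QuotientGroup.rightRel H) (a i * g) =
        Quotient.mk (QuotientGroup.rightRel H) g := by
      refine Quotient.sound (s := QuotientGroup.rightRel H) ?_
      change QuotientGroup.rightRel H _ _
      rw [QuotientGroup.rightRel_apply]
      have h1 : a i ∈ H := Subgroup.subset_closure ⟨i, rfl⟩
      simpa using h1
    simp only [rep, this]
  choose w hw hwp using hrep
  have hstep : ∀ i g, (w g).head? ≠ some i → (w (a i * g)).head? = some i := by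
    intro i g hg
    have : w (a i * g) = i :: w g := by
      refine reducedWord_unique ha hfree _ _ (hw _) ?_ ?_
      · rw [List.isChain_cons]
        refine ⟨fun j hj hij => hg ?_, hw g⟩
        subst hij
        exact hj
      · rw [hwp, hrep_mul, List.map_cons, List.prod_cons, hwp, mul_assoc]
    simp [this]
  -- Multiplication by `a i` sends the complement of `A i` into `A i`, so two translates of `A i`
  -- cover the group and its mean is at least 1/2. Three disjoint sets of this kind have total mean
  -- at least 3/2.
  let A : Fin 3 → Set G := fun i => {g | (w g).head? = some i}
  have hA : ∀ i, 1 ≤ 2 * m.toFun (A i) := by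
    intro i
    have hcover : (univ : Set G) ⊆ A i ∪ (fun h => a i * h) '' A i := by
      intro g _
      by_cases hg : (w g).head? = some i
      · exact Or.inl hg
      · exact Or.inr ⟨a i * g, hstep i g hg, by simp [← mul_assoc, ha]⟩
    have h1 := (m.mono hcover).trans (m.union_le _ _)
    rw [m.univ, hm] at h1
    linarith
  have hdisj : ∀ i j, i ≠ j → Disjoint (A i) (A j) := by
    intro i j hij
    refine Set.disjoint_left.2 fun g hi hj => hij ?_
    have hi' : (w g).head? = some i := hi
    have hj' : (w g).head? = some j := hj
    simpa [hi'] using hj'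
  have h01 := m.union (A 0) (A 1) (hdisj 0 1 (by decide))
  have h012 := m.union (A 0 ∪ A 1) (A 2)
    (Disjoint.union_left (hdisj 0 2 (by decide)) (hdisj 1 2 (by decide)))
  have hle := m.mono (subset_univ (A 0 ∪ A 1 ∪ A 2))
  rw [m.univ] at hle
  linarith [hA 0, hA 1, hA 2]

end Involutions

/-! ### A zero-one law and nonsmoothness -/

section ZeroOne

open MeasureTheory ProbabilityTheory Filter

/-- The fair coin. -/
noncomputable def fairCoin : Measure Bool := (PMF.uniformOfFintype Bool).toMeasure

instance : IsProbabilityMeasure fairCoin := by unfold fairCoin; infer_instance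

/-- The distribution of a sequence of independent fair coins. -/
noncomputable def fairCoins : Measure (ℕ → Bool) := Measure.infinitePi fun _ => fairCoin

instance : IsProbabilityMeasure fairCoins := by unfold fairCoins; infer_instance

theorem fairCoin_singleton (b : Bool) : fairCoin {b} = 2⁻¹ := by
  rw [fairCoin, PMF.toMeasure_apply_singleton _ _ (measurableSet_singleton _)]
  simp

theorem fairCoins_singleton (z : ℕ → Bool) : fairCoins {z} = 0 := by
  have hle : ∀ n : ℕ, fairCoins {z} ≤ 2⁻¹ ^ n := by
    intro n
    have h : fairCoins (Set.pi (Finset.range n) fun i => {z i}) = 2⁻¹ ^ n := by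
      rw [fairCoins, Measure.infinitePi_pi _ fun i _ => measurableSet_singleton _]
      simp [fairCoin_singleton]
    rw [← h]
    exact measure_mono (by rintro _ rfl i _; rfl)
  have hlim : Tendsto (fun n : ℕ => (2⁻¹ : ENNReal) ^ n) atTop (𝓝 0) :=
    ENNReal.tendsto_pow_atTop_nhds_zero_of_lt_one (by norm_num)
  exact le_antisymm (ge_of_tendsto' hlim hle) zero_le

/-- Kolmogorov's zero-one law applies: overwriting the first `n` coordinates does not affect
membership in `S`, so `S` is measurable with respect to the coordinates from `n` on, for every `n`.
-/
theorem fairCoins_eq_zero_or_one {S : Set (ℕ → Bool)} (hS : MeasurableSet S)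
    (hinv : ∀ z z' : ℕ → Bool, {n | z n ≠ z' n}.Finite → z ∈ S → z' ∈ S) :
    fairCoins S = 0 ∨ fairCoins S = 1 := by
  let s : ℕ → MeasurableSpace (ℕ → Bool) := fun n =>
    MeasurableSpace.comap (fun z : ℕ → Bool => z n) ⊤
  have hindep : iIndep s fairCoins :=
    iIndepFun_infinitePi (P := fun _ : ℕ => fairCoin) (X := fun _ b => b) fun _ => measurable_id
  refine measure_zero_or_one_of_measurableSet_limsup_atTop
    (fun n => (measurable_pi_apply n).comap_le) hindep ?_
  rw [limsup_eq_iInf_iSup_of_nat, MeasurableSpace.measurableSet_iInf]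
  intro n
  let erase : (ℕ → Bool) → (ℕ → Bool) := fun z i => if n ≤ i then z i else false
  have herase : Measurable[⨆ i ≥ n, s i] erase := by
    refine @measurable_pi_lambda _ _ _ (_) _ _ fun i => ?_
    by_cases hi : n ≤ i
    · simp only [erase, hi, if_true]
      exact (comap_measurable (fun z : ℕ → Bool => z i)).mono (le_iSup₂_of_le i hi le_rfl) le_rfl
    · simp only [erase, hi, if_false]
      exact @measurable_const _ _ (_) (_) _
  have hfin : ∀ z, {i | z i ≠ erase z i}.Finite := fun z =>
    (finite_lt_nat n).subset fun i hi => by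
      by_contra hni
      have hni' : n ≤ i := not_lt.1 hni
      exact hi (by simp [erase, hni'])
  have hpre : S = erase ⁻¹' S := by
    ext z
    refine ⟨hinv _ _ (hfin z), hinv _ _ ?_⟩
    simpa only [ne_comm] using hfin z
  rw [hpre]
  exact herase hS

/-- If eventual equality of binary sequences maps to `E` in a measurable way and with countable
fibers, then `E` is not smooth. -/
theorem not_isSmooth_of_eventuallyEq {X : Type*} [MeasurableSpace X] {E : Setoid X}
    {f : (ℕ → Bool) → X} (hf : Measurable f)
    (hinv : ∀ z z' : ℕ → Bool, {n | z n ≠ z' n}.Finite → E (f z) (f z'))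
    (hcount : ∀ z, {z' | E (f z') (f z)}.Countable) : ¬ IsSmooth E := by
  rintro ⟨Y, _, _, φ, hφ, hE⟩
  have hmeas : Measurable fun z => φ (f z) := hφ.comp hf
  have : Nonempty Y := ⟨φ (f fun _ => false)⟩
  -- Preimages of Borel sets have measure 0 or 1, and countably many Borel sets separate the points
  -- of `Y`.
  obtain ⟨y, hy⟩ : ∃ y, (fun z => φ (f z)) =ᵐ[fairCoins] Function.const _ y := by
    refine exists_eventuallyEq_const_of_forall_separating MeasurableSet fun U hU => ?_
    have hpre : MeasurableSet {z | φ (f z) ∈ U} := hmeas hU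
    rcases fairCoins_eq_zero_or_one hpre (fun z z' hzz' hz => by
      have : φ (f z) = φ (f z') := (hE _ _).1 (hinv z z' hzz')
      rw [Set.mem_ofPred_eq] at hz ⊢
      rwa [← this]) with h | h
    · right
      exact measure_eq_zero_iff_ae_notMem.1 h
    · left
      exact (mem_ae_iff_prob_eq_one hpre).2 h
  obtain ⟨z, hz⟩ := hy.exists
  have hc := hcount z
  have hnull : fairCoins {z' | E (f z') (f z)} = 0 := by
    rw [← biUnion_of_singleton {z' | E (f z') (f z)}, measure_biUnion_null_iff hc]
    exact fun z _ => fairCoins_singleton z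
  have hone : ∀ᵐ z' ∂fairCoins, z' ∉ {z' | E (f z') (f z)} := measure_eq_zero_iff_ae_notMem.1 hnull
  obtain ⟨z', h1, h2⟩ := (hone.and hy).exists
  exact h1 ((hE _ _).2 (h2.trans hz.symm))

end ZeroOne

noncomputable section

/-! ### Orbit closures -/

section OrbitClosure

variable {Γ : Type*} [AddCommGroup Γ] {A : Type*} [TopologicalSpace A]

theorem continuous_leftShift (s : Γ) : Continuous (leftShift s : (Γ → A) → Γ → A) :=
  continuous_pi fun _ => continuous_apply _

/-- The closure of the orbit of a configuration. -/
def orbitClosure (x : Γ → A) : Subshift A Γ where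
  carrier := closure (range fun s : Γ => leftShift s x)
  isClosed := isClosed_closure
  mapsTo g := by
    refine MapsTo.closure ?_ (continuous_leftShift (-g) |>.congr fun y => ?_)
    · rintro _ ⟨s, rfl⟩
      refine ⟨-g + s, funext fun t => ?_⟩
      change x _ = x _
      congr 1
      abel
    · funext t
      change y _ = y _
      rw [neg_neg]

theorem leftShift_mem_orbitClosure (s : Γ) (x : Γ → A) :
    leftShift s x ∈ (orbitClosure x).carrier := subset_closure ⟨s, rfl⟩

theorem self_mem_orbitClosure (x : Γ → A) : x ∈ (orbitClosure x).carrier :=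
  subset_closure ⟨0, funext fun t => by simp [leftShift]⟩

theorem orbitClosure_subset_iff {x : Γ → A} {K : Set (Γ → A)} (hK : IsClosed K) :
    (orbitClosure x).carrier ⊆ K ↔ ∀ s, leftShift s x ∈ K := by
  change closure _ ⊆ K ↔ _
  rw [hK.closure_subset_iff, range_subset_iff]

/-- Every point of the orbit closure agrees with a translate of `x` on any finite window. -/
theorem exists_translate_eqOn [DiscreteTopology A] {x y : Γ → A}
    (hy : y ∈ (orbitClosure x).carrier) (F : Finset Γ) : ∃ s, ∀ f ∈ F, y f = x (f + s) := by
  have hopen : IsOpen {w : Γ → A | ∀ f ∈ F, w f = y f} := by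
    have : {w : Γ → A | ∀ f ∈ F, w f = y f} = ⋂ f ∈ F, {w | w f = y f} := by ext; simp
    rw [this]
    exact isOpen_biInter_finset fun f _ =>
      (isOpen_discrete {y f}).preimage (continuous_apply (A := fun _ : Γ => A) f)
  obtain ⟨_, hw, s, rfl⟩ := mem_closure_iff.1 hy _ hopen fun f _ => rfl
  refine ⟨-s, fun f hf => ?_⟩
  rw [← hw f hf, add_comm]
  rfl

end OrbitClosure

/-! ### Locally determined functions -/

section LocallyDetermined

variable {Γ : Type*} [AddCommGroup Γ] {A B C : Type*}

/-- The value of `g` at `t` depends only on `x` in a finite window around `t`. -/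
def LocallyDetermines (x : Γ → A) (g : Γ → B) : Prop :=
  ∃ F : Finset Γ, ∀ t t', (∀ f ∈ F, x (f + t) = x (f + t')) → g t = g t'

theorem LocallyDetermines.trans {x : Γ → A} {y : Γ → B} {z : Γ → C}
    (h : LocallyDetermines x y) (k : LocallyDetermines y z) : LocallyDetermines x z := by
  classical
  obtain ⟨F, hF⟩ := h
  obtain ⟨K, hK⟩ := k
  refine ⟨Finset.image₂ (· + ·) F K, fun t t' hx => hK t t' fun f hf => hF _ _ fun e he => ?_⟩
  rw [← add_assoc, ← add_assoc]
  exact hx _ (Finset.mem_image₂_of_mem he hf)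

theorem LocallyDetermines.prodMk {x : Γ → A} {y : Γ → B} {z : Γ → C}
    (h : LocallyDetermines x y) (k : LocallyDetermines x z) :
    LocallyDetermines x fun t => (y t, z t) := by
  classical
  obtain ⟨F, hF⟩ := h
  obtain ⟨K, hK⟩ := k
  refine ⟨F ∪ K, fun t t' hx => ?_⟩
  exact Prod.ext (hF t t' fun f hf => hx f (Finset.mem_union_left _ hf))
    (hK t t' fun f hf => hx f (Finset.mem_union_right _ hf))

theorem LocallyDetermines.comp {x : Γ → A} {y : Γ → B} (h : LocallyDetermines x y) (p : B → C) :
    LocallyDetermines x fun t => p (y t) := by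
  obtain ⟨F, hF⟩ := h
  exact ⟨F, fun t t' hx => congrArg p (hF t t' hx)⟩

theorem LocallyDetermines.refl (x : Γ → A) : LocallyDetermines x x :=
  ⟨{0}, fun t t' h => by simpa using h⟩

theorem LocallyDetermines.translate {x : Γ → A} {y : Γ → B} (h : LocallyDetermines x y) (s : Γ) :
    LocallyDetermines x fun t => y (s + t) :=
  h.trans ⟨{s}, fun t t' h => by simpa using h⟩

theorem LocallyDetermines.exists_blockCode {x : Γ → A} {y : Γ → B} (h : LocallyDetermines x y) :
    ∃ (F : Finset Γ) (c : (F → A) → B), ∀ t, y t = c fun f => x (f + t) := by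
  classical
  obtain ⟨F, hF⟩ := h
  -- Patterns that do not occur in `x` get the irrelevant value `y 0`.
  refine ⟨F, fun p => if h : ∃ t, (fun f : F => x (f + t)) = p then y h.choose else y 0,
    fun t => ?_⟩
  have hex : ∃ t', (fun f : F => x (f + t')) = fun f : F => x (f + t) := ⟨t, rfl⟩
  refine Eq.trans ?_ (dif_pos hex).symm
  exact hF _ _ fun f hf => (congrFun hex.choose_spec ⟨f, hf⟩).symm

variable [TopologicalSpace A] [TopologicalSpace B]

theorem LocallyDetermines.exists_factor [DiscreteTopology A] {x : Γ → A} {y : Γ → B} (h : LocallyDetermines x y) :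
    ∃ Φ : (Γ → A) → (Γ → B), Continuous Φ ∧ (∀ s w, Φ (leftShift s w) = leftShift s (Φ w)) ∧
      Φ x = y := by
  obtain ⟨F, c, hc⟩ := h.exists_blockCode
  refine ⟨fun w t => c fun f => w (f + t), ?_, ?_, ?_⟩
  · refine continuous_pi fun t => continuous_of_discreteTopology.comp ?_
    exact continuous_pi fun f => continuous_apply _
  · intro s w
    funext t
    change c _ = c _
    congr 1
    funext f
    change w _ = w _
    congr 1
    abel
  · funext t
    exact (hc t).symm

theorem mapsTo_orbitClosure {x : Γ → A} {y : Γ → B} {Φ : (Γ → A) → (Γ → B)} (hΦ : Continuous Φ)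
    (hs : ∀ s w, Φ (leftShift s w) = leftShift s (Φ w)) (hxy : Φ x = y) :
    MapsTo Φ (orbitClosure x).carrier (orbitClosure y).carrier := by
  refine MapsTo.closure ?_ hΦ
  rintro _ ⟨s, rfl⟩
  exact ⟨s, by simp only [hs, hxy]⟩

/-- The identity holds at `x`, passes to the orbit by equivariance, and to the closure by
continuity. -/
theorem leftInverse_on_orbitClosure [T2Space A] {x : Γ → A} {y : Γ → B} {Φ : (Γ → A) → (Γ → B)}
    {Ψ : (Γ → B) → (Γ → A)} (hΦ : Continuous Φ) (hΨ : Continuous Ψ)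
    (hΦs : ∀ s w, Φ (leftShift s w) = leftShift s (Φ w))
    (hΨs : ∀ s w, Ψ (leftShift s w) = leftShift s (Ψ w)) (hxy : Φ x = y) (hyx : Ψ y = x) :
    ∀ w ∈ (orbitClosure x).carrier, Ψ (Φ w) = w := by
  have : (orbitClosure x).carrier ⊆ {w | Ψ (Φ w) = w} := by
    refine (orbitClosure_subset_iff (isClosed_eq (hΨ.comp hΦ) continuous_id)).2 fun s => ?_
    change Ψ (Φ _) = _
    rw [hΦs, hΨs, hxy, hyx]
    rfl
  exact this

theorem topologicalConjugacy_orbitClosure [DiscreteTopology A] {x y : Γ → A} (h : LocallyDetermines x y)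
    (k : LocallyDetermines y x) :
    topologicalConjugacy Γ A (orbitClosure x) (orbitClosure y) := by
  obtain ⟨Φ, hΦ, hΦs, hxy⟩ := h.exists_factor
  obtain ⟨Ψ, hΨ, hΨs, hyx⟩ := k.exists_factor
  refine ⟨⟨⟨fun w => ⟨Φ w.1, mapsTo_orbitClosure hΦ hΦs hxy w.2⟩,
    fun w => ⟨Ψ w.1, mapsTo_orbitClosure hΨ hΨs hyx w.2⟩, fun w => Subtype.ext ?_,
    fun w => Subtype.ext ?_⟩, ?_, ?_⟩, fun s w => Subtype.ext (hΦs s w.1)⟩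
  · exact leftInverse_on_orbitClosure hΦ hΨ hΦs hΨs hxy hyx w.1 w.2
  · exact leftInverse_on_orbitClosure hΨ hΦ hΨs hΦs hyx hxy w.1 w.2
  · exact (hΦ.comp continuous_subtype_val).subtype_mk _
  · exact (hΨ.comp continuous_subtype_val).subtype_mk _

/-- If `x` locally determines functions with arbitrarily sparse common periods, its orbit closure
is free. -/
theorem isFreeSubshift_orbitClosure [DiscreteTopology A] {x : Γ → A}
    (h : ∀ s : Γ, s ≠ 0 → ∃ (B : Type) (g : Γ → B), LocallyDetermines x g ∧
      ∀ t, g (s + t) ≠ g t) :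
    IsFreeSubshift (orbitClosure x) := by
  classical
  rintro s ⟨y, hy⟩ hsy
  by_contra hs
  obtain ⟨B, g, ⟨F, hF⟩, hg⟩ := h s hs
  have hsy' : leftShift s y = y := congrArg Subtype.val hsy
  -- The window contains `F` and `s + F`, so the period `s` of `y` makes `x` look alike around `r`
  -- and `s + r`; then `g` agrees there.
  obtain ⟨r, hr⟩ := exists_translate_eqOn hy (F ∪ F.image (s + ·))
  refine hg r (hF _ _ fun f hf => ?_)
  have h1 := hr f (Finset.mem_union_left _ hf)
  have h2 := hr (s + f) (Finset.mem_union_right _ (Finset.mem_image_of_mem _ hf))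
  rw [← h1, ← add_assoc, add_comm f s, ← h2]
  have h3 : y (-s + (s + f)) = y (s + f) := congrFun hsy' (s + f)
  rw [neg_add_cancel_left] at h3
  exact h3.symm

end LocallyDetermined

/-! ### The Borel structure on the space of subshifts -/

section Borel

open TopologicalSpace

variable {Γ : Type*} [AddCommGroup Γ] {A : Type*} [TopologicalSpace A]

theorem carrier_injective :
    Function.Injective (Subshift.carrier : Subshift A Γ → Set (Γ → A)) := by
  rintro ⟨X, _, _⟩ ⟨Y, _, _⟩ h
  cases h
  rfl

/-- The clopen sets of configurations give a countable subbasis of the Vietoris topology. -/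
def subshiftSubbasis (Γ : Type*) [AddCommGroup Γ] (A : Type*) [TopologicalSpace A] :
    Set (Set (Subshift A Γ)) :=
  range (fun K : Clopens (Γ → A) => {X : Subshift A Γ | X.carrier ⊆ K}) ∪
    range fun K : Clopens (Γ → A) => {X : Subshift A Γ | (X.carrier ∩ K).Nonempty}

variable [DiscreteTopology A] [Finite A]

/-- The full shift is compact and zero-dimensional: a clopen set fits between a closed set and an
open set containing it. For countable `Γ` there are only countably many clopen sets, which makes the
Borel structure tractable. -/
theorem subshiftTopology_eq_generateFrom :
    (subshiftTopology : TopologicalSpace (Subshift A Γ)) =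
      generateFrom (subshiftSubbasis Γ A) := by
  have hvi : (subshiftTopology : TopologicalSpace (Subshift A Γ)) =
      generateFrom (preimage Subshift.carrier '' (powerset '' {U | IsOpen U} ∪
        (fun V => {s | (s ∩ V).Nonempty}) '' {V | IsOpen V})) := by
    rw [subshiftTopology, TopologicalSpace.vietoris, induced_generateFrom_eq]
  rw [hvi]
  apply le_antisymm
  · refine le_generateFrom ?_
    rintro _ (⟨K, rfl⟩ | ⟨K, rfl⟩)
    · exact isOpen_generateFrom_of_mem ⟨_, Or.inl ⟨K, K.isClopen.isOpen, rfl⟩, rfl⟩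
    · exact isOpen_generateFrom_of_mem ⟨_, Or.inr ⟨K, K.isClopen.isOpen, rfl⟩, rfl⟩
  · refine le_generateFrom ?_
    rintro _ ⟨_, ⟨U, hU, rfl⟩ | ⟨U, hU, rfl⟩, rfl⟩
    · have : Subshift.carrier ⁻¹' powerset U = ⋃ K ∈ {K : Clopens (Γ → A) | (K : Set _) ⊆ U},
          {X : Subshift A Γ | X.carrier ⊆ K} := by
        ext X
        simp only [mem_preimage, mem_powerset_iff, mem_iUnion, mem_ofPred_eq, exists_prop]
        refine ⟨fun h => ?_, fun ⟨K, hK, hX⟩ => hX.trans hK⟩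
        obtain ⟨K, hK, hX, hKU⟩ := exists_clopen_of_closed_subset_open X.isClosed hU h
        exact ⟨⟨K, hK⟩, hKU, hX⟩
      rw [this]
      exact @isOpen_biUnion _ _ (_) _ _ fun K _ => isOpen_generateFrom_of_mem (Or.inl ⟨K, rfl⟩)
    · have : Subshift.carrier ⁻¹' {s | (s ∩ U).Nonempty} =
          ⋃ K ∈ {K : Clopens (Γ → A) | (K : Set _) ⊆ U},
            {X : Subshift A Γ | (X.carrier ∩ K).Nonempty} := by
        ext X
        simp only [mem_preimage, mem_iUnion, mem_ofPred_eq, exists_prop]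
        refine ⟨fun ⟨x, hx, hxU⟩ => ?_, fun ⟨K, hK, x, hx, hxK⟩ => ⟨x, hx, hK hxK⟩⟩
        obtain ⟨K, hK, hxK, hKU⟩ := compact_exists_isClopen_in_isOpen (show IsOpen U from hU) hxU
        exact ⟨⟨K, hK⟩, hKU, x, hx, hxK⟩
      rw [this]
      exact @isOpen_biUnion _ _ (_) _ _ fun K _ => isOpen_generateFrom_of_mem (Or.inr ⟨K, rfl⟩)

variable [Countable Γ]

instance countable_clopens_fullShift : Countable (Clopens (Γ → A)) :=
  Clopens.countable_iff_secondCountable.2 inferInstance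

theorem subshiftBorel_eq_generateFrom :
    (subshiftBorel : MeasurableSpace (Subshift A Γ)) =
      MeasurableSpace.generateFrom (subshiftSubbasis Γ A) := by
  have hc : (subshiftSubbasis Γ A).Countable :=
    (countable_range _).union (countable_range _)
  have : SecondCountableTopology (Subshift A Γ) :=
    ⟨_, hc, subshiftTopology_eq_generateFrom⟩
  exact borel_eq_generateFrom_of_subbasis subshiftTopology_eq_generateFrom

/-- An orbit closure lies in a clopen set exactly when all of the countably many translates do, and
it meets the clopen set exactly when it is not contained in the complement. -/
theorem measurable_orbitClosure {Z : Type*} [TopologicalSpace Z] [MeasurableSpace Z]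
    [OpensMeasurableSpace Z] {x : Z → Γ → A} (hx : Continuous x) :
    Measurable fun z => orbitClosure (x z) := by
  have key : ∀ K : Clopens (Γ → A),
      MeasurableSet {z | (orbitClosure (x z)).carrier ⊆ (K : Set (Γ → A))} := by
    intro K
    simp_rw [orbitClosure_subset_iff K.isClopen.isClosed, ofPred_forall]
    refine MeasurableSet.iInter fun s => ?_
    exact (K.isClopen.isOpen.preimage ((continuous_leftShift s).comp hx)).measurableSet
  rw [subshiftBorel_eq_generateFrom]
  refine measurable_generateFrom ?_
  rintro _ (⟨K, rfl⟩ | ⟨K, rfl⟩)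
  · exact key K
  · have : (fun z => orbitClosure (x z)) ⁻¹' {X : Subshift A Γ | (X.carrier ∩ K).Nonempty} =
        {z | (orbitClosure (x z)).carrier ⊆ ((Kᶜ : Clopens (Γ → A)) : Set (Γ → A))}ᶜ := by
      ext z
      simp [not_subset, Set.Nonempty]
    rw [this]
    exact (key _).compl

/-- A conjugacy is given by a block code, so conjugacy classes are countable. -/
theorem countable_conjugacyClass (X : Subshift A Γ) :
    {Y | topologicalConjugacy Γ A Y X}.Countable := by
  have : CompactSpace X.carrier := isCompact_iff_compactSpace.1 X.isClosed.isCompact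
  have : Countable (Clopens X.carrier) := Clopens.countable_iff_secondCountable.2 inferInstance
  -- A conjugacy onto `Y` is determined by the clopen sets on which the symbol at the origin is
  -- constant, and `Y` is the set of itineraries through them. Only countably many such families
  -- exist.
  let image : (A → Clopens X.carrier) → Set (Γ → A) := fun C =>
    {y | ∃ x : X.carrier, ∀ t : Γ, (-t) +ᵥ x ∈ C (y t)}
  refine ((countable_range image).preimage carrier_injective).mono ?_
  rintro Y hY
  obtain ⟨φ, hφ⟩ := (topologicalConjugacy Γ A).symm hY
  have hcont : Continuous fun x => (φ x).1 0 :=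
    (continuous_apply (0 : Γ)).comp (continuous_subtype_val.comp φ.continuous)
  refine ⟨fun a => ⟨(fun x => (φ x).1 0) ⁻¹' {a}, (isClopen_discrete {a}).preimage hcont⟩, ?_⟩
  have hval : ∀ (x : X.carrier) (t : Γ), (φ ((-t) +ᵥ x)).1 0 = (φ x).1 t := by
    intro x t
    rw [hφ]
    change (φ x).1 (- -t + 0) = _
    simp
  ext y
  constructor
  · rintro ⟨x, hx⟩
    have : (φ x).1 = y := funext fun t => (hval x t).symm.trans (hx t)
    exact this ▸ (φ x).2
  · intro hy
    refine ⟨φ.symm ⟨y, hy⟩, fun t => ?_⟩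
    change (φ _).1 0 = y t
    rw [hval, φ.apply_symm_apply]

end Borel

/-! ### Involutions in the topological full group -/

section FullGroup

variable {Γ : Type*} [AddCommGroup Γ] {A ι : Type*} [TopologicalSpace A]

/-- Adjacent edges in direction `e` never carry the same color. -/
def IsProperlyColored (X : Subshift A Γ) (color : A → Option ι) (e : Γ) : Prop :=
  ∀ x ∈ X.carrier, ∀ c, color (x 0) = some c → color (x e) ≠ some c

variable {X : Subshift A Γ} {color : A → Option ι} {e : Γ}

theorem val_vadd_apply (s : Γ) (x : X.carrier) (t : Γ) : (s +ᵥ x).1 t = x.1 (-s + t) := rfl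

variable [DecidableEq ι]

/-- The direction in which a point moves along the edge of color `c` at the origin. -/
def edgeCocycle (X : Subshift A Γ) (color : A → Option ι) (e : Γ) (c : ι) (x : X.carrier) : Γ :=
  -- The symbol at `t` colors the edge from `t` to `t + e`. Acting by `-e` moves the origin to
  -- position `e`, across the edge ahead; the second case crosses the edge behind.
  if color (x.1 0) = some c then -e else if color (x.1 (-e)) = some c then e else 0

/-- After an edge is crossed, the same edge is seen from its other end. Proper coloring rules out a
second edge of that color there, so the next move goes back. -/
theorem involutive_edgeCocycle_vadd (hX : IsProperlyColored X color e) (c : ι) :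
    Function.Involutive fun x : X.carrier => edgeCocycle X color e c x +ᵥ x := by
  intro x
  have hx := hX x.1 x.2 c
  have hx' := hX _ (e +ᵥ x).2 c
  simp only [val_vadd_apply, add_zero, neg_add_cancel] at hx'
  have hneg := hX _ ((-e) +ᵥ x).2 c
  by_cases h0 : color (x.1 0) = some c
  · have : edgeCocycle X color e c x = -e := if_pos h0
    simp only [this]
    have h1 : edgeCocycle X color e c ((-e) +ᵥ x) = e := by
      rw [edgeCocycle, val_vadd_apply, val_vadd_apply]
      simp [hx h0, h0]
    rw [h1, vadd_vadd, add_neg_cancel, zero_vadd]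
  · by_cases h1 : color (x.1 (-e)) = some c
    · have : edgeCocycle X color e c x = e := by rw [edgeCocycle, if_neg h0, if_pos h1]
      simp only [this]
      have h2 : edgeCocycle X color e c (e +ᵥ x) = -e := by
        rw [edgeCocycle, val_vadd_apply]
        simp [h1]
      rw [h2, vadd_vadd, neg_add_cancel, zero_vadd]
    · have : edgeCocycle X color e c x = 0 := by rw [edgeCocycle, if_neg h0, if_neg h1]
      simp only [this, zero_vadd]

variable [DiscreteTopology A]

theorem isLocallyConstant_edgeCocycle (c : ι) :
    IsLocallyConstant (edgeCocycle X color e c) := by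
  have hcont : Continuous fun x : X.carrier => (x.1 0, x.1 (-e)) :=
    ((continuous_apply (0 : Γ)).comp continuous_subtype_val).prodMk
      ((continuous_apply (-e)).comp continuous_subtype_val)
  exact (IsLocallyConstant.of_discrete (fun p : A × A =>
    if color p.1 = some c then -e else if color p.2 = some c then e else 0)).comp_continuous hcont

theorem continuous_edgeCocycle_vadd (c : ι) :
    Continuous fun x : X.carrier => edgeCocycle X color e c x +ᵥ x := by
  refine continuous_iff_continuousAt.2 fun x => ?_
  have hcont : Continuous fun y : X.carrier => edgeCocycle X color e c x +ᵥ y :=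
    ((continuous_leftShift _).comp continuous_subtype_val).subtype_mk _
  refine hcont.continuousAt.congr ?_
  filter_upwards [(isLocallyConstant_edgeCocycle c).eventually_eq x] with y hy
  exact congrArg (· +ᵥ y) hy.symm

/-- The involution moving every point along its edge of color `c`. -/
def edgeInvolution (hX : IsProperlyColored X color e) (c : ι) :
    topologicalFullGroup Γ X.carrier :=
  ⟨{ (involutive_edgeCocycle_vadd hX c).toPerm with
      continuous_toFun := continuous_edgeCocycle_vadd c
      continuous_invFun := continuous_edgeCocycle_vadd c }, by
    refine (isPiecewiseTranslation_iff _).2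
      ⟨edgeCocycle X color e c, isLocallyConstant_edgeCocycle c, ?_, fun x => rfl⟩
    refine (toFinite {-e, e, 0}).subset ?_
    rintro _ ⟨x, rfl⟩
    unfold edgeCocycle
    split_ifs <;> simp⟩

theorem edgeInvolution_apply (hX : IsProperlyColored X color e) (c : ι) (x : X.carrier) :
    (edgeInvolution hX c).1 x = edgeCocycle X color e c x +ᵥ x := rfl

theorem edgeInvolution_mul_self (hX : IsProperlyColored X color e) (c : ι) :
    edgeInvolution hX c * edgeInvolution hX c = 1 :=
  Subtype.ext (Homeomorph.ext fun x => involutive_edgeCocycle_vadd hX c x)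

/-- A word in the involutions moves a point along a path labeled by that word. -/
theorem prod_edgeInvolution_apply (hX : IsProperlyColored X color e) (l : List ι) :
    ∀ x : X.carrier, (∀ m (hm : m < l.length), color (x.1 (m • e)) = some l[m]) →
      ((l.map (edgeInvolution hX)).prod).1 (-(l.length • e) +ᵥ x) = x := by
  induction l with
  | nil =>
    intro x _
    simp
  | cons c t ih =>
    intro x hx
    have h0 : color (x.1 0) = some c := by
      have := hx 0 (by simp)
      rwa [zero_nsmul] at this
    have ht := ih ((-e) +ᵥ x) fun m hm => by
      have := hx (m + 1) (by simpa using hm)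
      rw [val_vadd_apply, neg_neg, ← succ_nsmul']
      simpa using this
    -- The last letter acts first, so the path starts at position `length • e` and is walked back to
    -- the origin.
    have hstart : -((c :: t).length • e) +ᵥ x = -(t.length • e) +ᵥ ((-e) +ᵥ x) := by
      rw [vadd_vadd, List.length_cons, succ_nsmul, neg_add]
    rw [hstart, List.map_cons, List.prod_cons]
    change (edgeInvolution hX c).1 (((t.map (edgeInvolution hX)).prod).1 _) = x
    rw [ht, edgeInvolution_apply]
    have h1 : edgeCocycle X color e c ((-e) +ᵥ x) = e := by
      rw [edgeCocycle, val_vadd_apply, val_vadd_apply]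
      simp [hX x.1 x.2 c h0, h0]
    rw [h1, vadd_vadd, add_neg_cancel, zero_vadd]

/-- The product of a nonempty reduced word shifts some point by a nonzero multiple of `e`; by
freeness this is not the identity, so the involutions generate a free product. -/
theorem not_isAmenableGroup_topologicalFullGroup {color : A → Option (Fin 3)}
    (hfree : IsFreeSubshift X) (he : ∀ n : ℕ, n ≠ 0 → n • e ≠ 0)
    (hX : IsProperlyColored X color e)
    (hwords : ∀ l : List (Fin 3), l.IsChain (· ≠ ·) → ∃ x ∈ X.carrier,
      ∀ m (hm : m < l.length), color (x (m • e)) = some l[m]) :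
    ¬ IsAmenableGroup (topologicalFullGroup Γ X.carrier) := by
  refine not_isAmenableGroup_of_involutions (edgeInvolution_mul_self hX) fun l hl hne hprod => ?_
  obtain ⟨x, hxX, hx⟩ := hwords l hl
  have h := prod_edgeInvolution_apply hX l ⟨x, hxX⟩ hx
  rw [hprod] at h
  have h0 : -(l.length • e) = 0 := hfree _ _ h
  exact he l.length (by simpa using hne) (neg_eq_zero.1 h0)

end FullGroup

/-! ### A Toeplitz ruler sequence -/

/-- The `2`-adic valuation of `3 j + 1`. -/
def ruler (j : ℤ) : ℕ := padicValInt 2 (3 * j + 1)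

/-- Since `3 * j + 1` vanishes at no integer, the convention for the valuation of zero never
interferes and each level is a true valuation. -/
theorem le_ruler_iff {n : ℕ} {j : ℤ} : n ≤ ruler j ↔ (2 : ℤ) ^ n ∣ 3 * j + 1 := by
  have := padicValInt_dvd_iff (p := 2) n (3 * j + 1)
  rw [show ((2 : ℕ) : ℤ) = 2 from rfl] at this
  rw [this, ruler]
  constructor
  · exact Or.inr
  · rintro (h | h)
    · omega
    · exact h

theorem le_ruler_add_iff {n : ℕ} {j b : ℤ} (hb : (2 : ℤ) ^ n ∣ b) :
    n ≤ ruler (j + b) ↔ n ≤ ruler j := by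
  rw [le_ruler_iff, le_ruler_iff, show 3 * (j + b) + 1 = 3 * j + 1 + 3 * b by ring]
  exact dvd_add_left (hb.mul_left 3)

theorem ruler_add_of_dvd {j b : ℤ} (hb : (2 : ℤ) ^ (ruler j + 1) ∣ b) :
    ruler (j + b) = ruler j := by
  have h1 := le_ruler_add_iff (j := j) hb
  have h2 := le_ruler_add_iff (j := j) ((pow_dvd_pow 2 (Nat.le_succ (ruler j))).trans hb)
  omega

theorem exists_le_ruler (n : ℕ) : ∃ m, n ≤ ruler m := by
  have hcop : IsCoprime (3 : ℤ) (2 ^ n) := IsCoprime.pow_right ⟨1, -1, by norm_num⟩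
  obtain ⟨u, v, huv⟩ := hcop
  exact ⟨-u, le_ruler_iff.2 ⟨v, by linear_combination -huv⟩⟩

theorem ruler_add_pow {n : ℕ} {m : ℤ} (h : n + 1 ≤ ruler m) : ruler (m + 2 ^ n) = n := by
  refine le_antisymm ?_ ((le_ruler_add_iff dvd_rfl).2 (by omega))
  by_contra hlt
  rw [not_le, ← Nat.succ_le_iff, le_ruler_iff] at hlt
  rw [le_ruler_iff] at h
  have h3 : (2 : ℤ) ^ n * 2 ∣ 2 ^ n * 3 := by
    have h2 := dvd_sub hlt h
    rwa [show 3 * (m + 2 ^ n) + 1 - (3 * m + 1) = 2 ^ n * 3 by ring, Nat.succ_eq_add_one,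
      pow_succ] at h2
  have := (mul_dvd_mul_iff_left (by positivity)).1 h3
  omega

theorem ruler_surjective : Function.Surjective ruler := fun n =>
  let ⟨_, hm⟩ := exists_le_ruler (n + 1)
  ⟨_, ruler_add_pow hm⟩

/-- The parity of the ruler sequence. -/
def rulerParity (j : ℤ) : Bool := decide (ruler j % 2 = 0)

/-- A level equal to `n` is unchanged by a step of `2 ^ (n + 1)`. If the level exceeds `n` but has
the same parity, it is at least `n + 2`, and that step lands on level `n + 1`, of the wrong parity.
-/
theorem ruler_eq_iff_parity {n : ℕ} {j : ℤ} (h : n ≤ ruler j) :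
    ruler j = n ↔ rulerParity j = decide (n % 2 = 0) ∧
      rulerParity (2 ^ (n + 1) + j) = decide (n % 2 = 0) := by
  rw [add_comm _ j]
  constructor
  · intro hj
    have : ruler (j + 2 ^ (n + 1)) = n := by
      rw [ruler_add_of_dvd (by rw [hj]), hj]
    simp [rulerParity, this, hj]
  · rintro ⟨h1, h2⟩
    by_contra hne
    have hge : n + 1 ≤ ruler j := by omega
    have hge' : n + 1 ≤ ruler (j + 2 ^ (n + 1)) := (le_ruler_add_iff dvd_rfl).2 hge
    simp only [rulerParity, decide_eq_decide] at h1 h2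
    have : n + 1 + 1 ≤ ruler j := by omega
    have := ruler_add_pow this
    omega

theorem locallyDetermines_min_ruler (n : ℕ) :
    LocallyDetermines rulerParity fun j => min (ruler j) n := by
  induction n with
  | zero => exact ⟨∅, fun t t' _ => by simp⟩
  | succ n ih =>
    have h := ((ih.prodMk (.refl _)).prodMk ((LocallyDetermines.refl _).translate
      (2 ^ (n + 1)))).comp fun p : (ℕ × Bool) × Bool =>
        if p.1.1 < n then p.1.1 else
          if p.1.2 = decide (n % 2 = 0) ∧ p.2 = decide (n % 2 = 0) then n else n + 1
    convert h using 2 with j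
    dsimp only
    by_cases hlt : ruler j < n
    · rw [if_pos (by omega)]
      omega
    · rw [if_neg (by omega)]
      have := ruler_eq_iff_parity (not_lt.1 hlt)
      split_ifs with hp
      · have := this.2 hp
        omega
      · have := mt this.1 hp
        omega

/-- The positions of level at least `n` form a single residue class modulo `2 ^ n`. A window of
length `2 ^ n` meets this class, and the place where it does reveals the residue of `t`. -/
theorem locallyDetermines_intCast (n : ℕ) :
    LocallyDetermines rulerParity fun j : ℤ => (j : ZMod (2 ^ n)) := by
  refine (locallyDetermines_min_ruler n).trans
    ⟨(Finset.Ico 0 (2 ^ n)), fun t t' h => ?_⟩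
  obtain ⟨m, hm⟩ := exists_le_ruler n
  have hpos : (0 : ℤ) < 2 ^ n := by positivity
  have hf := h ((m - t) % 2 ^ n)
    (Finset.mem_Ico.2 ⟨Int.emod_nonneg _ hpos.ne', Int.emod_lt_of_pos _ hpos⟩)
  obtain ⟨q, hq⟩ : ∃ q, (m - t) % 2 ^ n + t = m + 2 ^ n * q :=
    ⟨-((m - t) / 2 ^ n), by linarith [Int.emod_add_mul_ediv (m - t) (2 ^ n)]⟩
  have h1 : n ≤ ruler ((m - t) % 2 ^ n + t) := by
    rw [hq, le_ruler_add_iff (dvd_mul_right _ _)]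
    exact hm
  have h2 : n ≤ ruler ((m - t) % 2 ^ n + t') := by
    dsimp only at hf
    omega
  rw [le_ruler_iff] at h1 h2
  have h3 : (2 : ℤ) ^ n ∣ 3 * (t - t') := by
    have h4 := dvd_sub h1 h2
    rwa [show ∀ k : ℤ, 3 * (k + t) + 1 - (3 * (k + t') + 1) = 3 * (t - t') by intro k; ring] at h4
  have hcop : IsCoprime ((2 : ℤ) ^ n) 3 := IsCoprime.pow_left ⟨-1, 1, by norm_num⟩
  have h4 := hcop.dvd_of_dvd_mul_left h3
  rw [ZMod.intCast_eq_intCast_iff_dvd_sub]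
  push_cast
  rw [← dvd_neg, neg_sub]
  exact h4

theorem LocallyDetermines.comp_fst {B C : Type*} {x : ℤ → B} {y : ℤ → C}
    (h : LocallyDetermines x y) :
    LocallyDetermines (fun t : ℤ × ℤ => x t.1) fun t : ℤ × ℤ => y t.1 := by
  obtain ⟨F, hF⟩ := h
  refine ⟨F.image fun f => (f, 0), fun t t' h => hF _ _ fun f hf => ?_⟩
  exact h (f, 0) (Finset.mem_image_of_mem _ hf)

theorem LocallyDetermines.comp_snd {B C : Type*} {x : ℤ → B} {y : ℤ → C}
    (h : LocallyDetermines x y) :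
    LocallyDetermines (fun t : ℤ × ℤ => x t.2) fun t : ℤ × ℤ => y t.2 := by
  obtain ⟨F, hF⟩ := h
  refine ⟨F.image fun f => (0, f), fun t t' h => hF _ _ fun f hf => ?_⟩
  exact h (0, f) (Finset.mem_image_of_mem _ hf)

/-! ### The configurations -/

/-- An enumeration of the reduced words in three involutions. -/
def reducedWord : ℕ → {l : List (Fin 3) // l.IsChain (· ≠ ·)} :=
  haveI : Nonempty {l : List (Fin 3) // l.IsChain (· ≠ ·)} := ⟨⟨[], by simp⟩⟩
  (exists_surjective_nat _).choose

theorem reducedWord_surjective : Function.Surjective reducedWord :=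
  haveI : Nonempty {l : List (Fin 3) // l.IsChain (· ≠ ·)} := ⟨⟨[], by simp⟩⟩
  (exists_surjective_nat _).choose_spec

/-- The periodic repetition of the `n`-th reduced word followed by a blank. -/
def edgeColor (n : ℕ) (i : ℤ) : Option (Fin 3) :=
  (reducedWord n).1[(i % ((reducedWord n).1.length + 1 : ℕ)).toNat]?

theorem edgeColor_add_of_dvd {n : ℕ} {i b : ℤ}
    (hb : (((reducedWord n).1.length + 1 : ℕ) : ℤ) ∣ b) : edgeColor n (i + b) = edgeColor n i := by
  rw [edgeColor, edgeColor, Int.add_emod, Int.emod_eq_zero_of_dvd hb, add_zero, Int.emod_emod]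

theorem edgeColor_natCast {n m : ℕ} (hm : m < (reducedWord n).1.length) :
    edgeColor n m = some (reducedWord n).1[m] := by
  have : ((m : ℤ) % ((reducedWord n).1.length + 1 : ℕ)).toNat = m := by
    rw [Int.emod_eq_of_lt (by omega) (by omega), Int.toNat_natCast]
  rw [edgeColor, this, List.getElem?_eq_getElem hm]

/-- Index `i` is not the blank, so index `i + 1` does not wrap around: it holds either the blank or
the next letter of a reduced word. -/
theorem edgeColor_succ_ne {n : ℕ} {i : ℤ} {c : Fin 3} (h : edgeColor n i = some c) :
    edgeColor n (1 + i) ≠ some c := by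
  intro h'
  have hchain := (reducedWord n).2
  unfold edgeColor at h h'
  generalize (reducedWord n).1 = l at h h' hchain
  obtain ⟨hr, hc⟩ := List.getElem?_eq_some_iff.1 h
  have hpos : (0 : ℤ) < (l.length + 1 : ℕ) := by positivity
  have h0 := Int.emod_nonneg i hpos.ne'
  have hsucc : ((1 + i) % (l.length + 1 : ℕ)).toNat = (i % (l.length + 1 : ℕ)).toNat + 1 := by
    have : (1 + i) % (l.length + 1 : ℕ) = i % (l.length + 1 : ℕ) + 1 := by
      rw [add_comm 1 i, ← Int.emod_add_emod]
      exact Int.emod_eq_of_lt (by omega) (by omega)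
    omega
  rw [hsucc] at h'
  obtain ⟨hr', hc'⟩ := List.getElem?_eq_some_iff.1 h'
  exact (List.isChain_iff_getElem.1 hchain _ hr') (hc.trans hc'.symm)

/-- A color of the edge to the right, a column symbol, a row symbol, and a bit. -/
abbrev LayerSymbol := Option (Fin 3) × Bool × Bool × Bool

/-- A coding of the symbols by the alphabet. -/
def symbolCode : LayerSymbol ↪ Fin 36 :=
  -- There are 4 · 2 · 2 · 2 = 32 symbols.
  (Function.Embedding.nonempty_of_card_le (by simp)).some

/-- The inverse of the coding. -/
def symbolDecode : Fin 36 → LayerSymbol := Function.invFun symbolCode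

theorem symbolDecode_code (a : LayerSymbol) : symbolDecode (symbolCode a) = a :=
  Function.leftInverse_invFun symbolCode.injective a

/-- The row `j` is the periodic repetition of the reduced word of index `ruler j`, decorated by the
ruler sequences of both coordinates and the bit of index `ruler j`. -/
def layers (z : ℕ → Bool) (t : ℤ × ℤ) : LayerSymbol :=
  (edgeColor (ruler t.2) t.1, rulerParity t.1, rulerParity t.2, z (ruler t.2))

/-- The Toeplitz function of a binary sequence. -/
def config (z : ℕ → Bool) (t : ℤ × ℤ) : Fin 36 := symbolCode (layers z t)

theorem isToeplitzFunction_of_forall {Γ A : Type*} [AddGroup Γ] [TopologicalSpace A]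
    [DiscreteTopology A] {x : Γ → A}
    (h : ∀ t, ∃ H : AddSubgroup Γ, H.FiniteIndex ∧ ∀ s ∈ H, x (t + s) = x t) :
    IsToeplitzFunction x := by
  let _ := profiniteTopology Γ
  refine continuous_iff_continuousAt.2 fun t => ?_
  obtain ⟨H, hH, hx⟩ := h t
  have hopen : IsOpen ((fun h => t + h) '' (H : Set Γ)) :=
    TopologicalSpace.isOpen_generateFrom_of_mem ⟨H, hH, t, rfl⟩
  refine (continuousAt_const (y := x t)).congr ?_
  filter_upwards [hopen.mem_nhds ⟨0, H.zero_mem, add_zero t⟩]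
  rintro _ ⟨s, hs, rfl⟩
  exact (hx s hs).symm

theorem isToeplitzFunction_config (z : ℕ → Bool) : IsToeplitzFunction (config z) := by
  refine isToeplitzFunction_of_forall fun t => ?_
  -- A common multiple of the periods of the two levels and of the repeated word; the symbol at `t`
  -- recurs along `Nℤ × Nℤ`.
  let N : ℕ := 2 ^ (ruler t.1 + 1) * 2 ^ (ruler t.2 + 1) * ((reducedWord (ruler t.2)).1.length + 1)
  have : NeZero N := ⟨by positivity⟩
  let π : ℤ × ℤ →+ ZMod N × ZMod N :=
    (Int.castAddHom (ZMod N)).prodMap (Int.castAddHom (ZMod N))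
  refine ⟨π.ker, inferInstance, fun s hs => ?_⟩
  have hs' : ((s.1 : ZMod N), (s.2 : ZMod N)) = 0 := hs
  have h1 : (N : ℤ) ∣ s.1 := (ZMod.intCast_zmod_eq_zero_iff_dvd _ _).1 (congrArg Prod.fst hs')
  have h2 : (N : ℤ) ∣ s.2 := (ZMod.intCast_zmod_eq_zero_iff_dvd _ _).1 (congrArg Prod.snd hs')
  have hr1 : ruler (t.1 + s.1) = ruler t.1 := by
    refine ruler_add_of_dvd (dvd_trans ?_ h1)
    exact_mod_cast (dvd_mul_right _ _).mul_right _
  have hr2 : ruler (t.2 + s.2) = ruler t.2 := by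
    refine ruler_add_of_dvd (dvd_trans ?_ h2)
    exact_mod_cast (dvd_mul_left _ _).mul_right _
  have hc : edgeColor (ruler t.2) (t.1 + s.1) = edgeColor (ruler t.2) t.1 := by
    refine edgeColor_add_of_dvd (dvd_trans ?_ h1)
    exact_mod_cast dvd_mul_left _ _
  simp only [config, layers, Prod.fst_add, Prod.snd_add, hr2, hc, rulerParity, hr1]

theorem locallyDetermines_layers (z : ℕ → Bool) : LocallyDetermines (config z) (layers z) := by
  simpa only [config, symbolDecode_code] using
    (LocallyDetermines.refl (config z)).comp symbolDecode

theorem locallyDetermines_column (z : ℕ → Bool) :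
    LocallyDetermines (config z) fun t => rulerParity t.1 :=
  (locallyDetermines_layers z).comp fun a => a.2.1

theorem locallyDetermines_row (z : ℕ → Bool) :
    LocallyDetermines (config z) fun t => rulerParity t.2 :=
  (locallyDetermines_layers z).comp fun a => a.2.2.1

theorem isFreeSubshift_config (z : ℕ → Bool) : IsFreeSubshift (orbitClosure (config z)) := by
  -- A nonzero `a` is not divisible by `2 ^ |a|`, which exceeds `|a|`.
  have key : ∀ a b : ℤ, a ≠ 0 → ((a + b : ℤ) : ZMod (2 ^ a.natAbs)) ≠ (b : ZMod _) := by
    intro a b ha h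
    rw [Int.cast_add, add_eq_right, ZMod.intCast_zmod_eq_zero_iff_dvd] at h
    refine ha (Int.eq_zero_of_abs_lt_dvd h ?_)
    rw [Int.abs_eq_natAbs]
    exact_mod_cast Nat.lt_two_pow_self
  refine isFreeSubshift_orbitClosure fun s hs => ?_
  by_cases h1 : s.1 = 0
  · have h2 : s.2 ≠ 0 := fun h2 => hs (Prod.ext h1 h2)
    exact ⟨_, _, (locallyDetermines_row z).trans (locallyDetermines_intCast s.2.natAbs).comp_snd,
      fun t => key s.2 t.2 h2⟩
  · exact ⟨_, _, (locallyDetermines_column z).trans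
      (locallyDetermines_intCast s.1.natAbs).comp_fst, fun t => key s.1 t.1 h1⟩

/-- Beyond some `N` the two sequences agree. The level truncated at `N + 1` is locally visible, so
the bits of levels up to `N` can be rewritten and the others copied. -/
theorem locallyDetermines_config {z z' : ℕ → Bool} (h : {n | z n ≠ z' n}.Finite) :
    LocallyDetermines (config z) (config z') := by
  obtain ⟨N, hN⟩ := h.bddAbove
  have hmin := (locallyDetermines_row z).trans (locallyDetermines_min_ruler (N + 1)).comp_snd
  have := ((locallyDetermines_layers z).prodMk hmin).comp fun p : LayerSymbol × ℕ =>
    symbolCode (p.1.1, p.1.2.1, p.1.2.2.1, if p.2 ≤ N then z' p.2 else p.1.2.2.2)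
  convert this using 2 with t
  have hbit : z' (ruler t.2) = if min (ruler t.2) (N + 1) ≤ N then z' (min (ruler t.2) (N + 1))
      else z (ruler t.2) := by
    split_ifs with hle
    · congr 1
      omega
    · by_contra hne
      exact hle ((min_le_left _ _).trans (hN (Ne.symm hne)))
  rw [config, layers, hbit]
  rfl

/-- A finite window identifies a row of level `n`, where the bit `z n` is displayed. Truncating at
`n + 1` separates level `n` from all higher ones. -/
theorem orbitClosure_config_injective :
    Function.Injective fun z => orbitClosure (config z) := by
  classical
  intro z z' h
  funext n
  have hmem : config z' ∈ (orbitClosure (config z)).carrier := by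
    have h' : orbitClosure (config z) = orbitClosure (config z') := h
    rw [h']
    exact self_mem_orbitClosure _
  obtain ⟨F, hF⟩ := (locallyDetermines_min_ruler (n + 1)).comp_snd
  obtain ⟨j, hj⟩ := ruler_surjective n
  obtain ⟨s, hs⟩ := exists_translate_eqOn hmem (insert (0, j) (F.image (· + (0, j))))
  have hlayers : ∀ f ∈ insert (0, j) (F.image (· + (0, j))),
      layers z' f = layers z (f + s) := fun f hf => symbolCode.injective (hs f hf)
  have hr := hF (0, j) ((0, j) + s) fun f hf => by
    rw [← add_assoc]
    exact congrArg (fun a : LayerSymbol => a.2.2.1)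
      (hlayers _ (Finset.mem_insert_of_mem (Finset.mem_image_of_mem _ hf)))
  have hr' : ruler ((0, j) + s).2 = n := by
    dsimp only at hr
    omega
  have hb := congrArg (fun a : LayerSymbol => a.2.2.2) (hlayers _ (Finset.mem_insert_self _ _))
  simp only [layers, hr', hj] at hb
  exact hb.symm

theorem isProperlyColored_config (z : ℕ → Bool) :
    IsProperlyColored (orbitClosure (config z)) (fun a => (symbolDecode a).1) (1, 0) := by
  intro x hx c h0
  obtain ⟨s, hs⟩ := exists_translate_eqOn hx {0, (1, 0)}
  simp only [hs _ (show (0 : ℤ × ℤ) ∈ _ by simp), zero_add, config, symbolDecode_code] at h0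
  simp only [hs _ (show ((1, 0) : ℤ × ℤ) ∈ _ by simp), config, symbolDecode_code]
  have := edgeColor_succ_ne h0
  simpa [layers] using this

theorem orbitClosure_config_mem (z : ℕ → Bool) :
    orbitClosure (config z) ∈ NAToepSubsh (ℤ × ℤ) (Fin 36) := by
  refine ⟨isFreeSubshift_config z, ⟨config z, isToeplitzFunction_config z, rfl⟩,
    not_isAmenableGroup_topologicalFullGroup (isFreeSubshift_config z) ?_
      (isProperlyColored_config z) ?_⟩
  · intro n hn h
    have := congrArg Prod.fst h
    simp at this
    exact hn this
  · intro l hl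
    obtain ⟨n, hn⟩ := reducedWord_surjective ⟨l, hl⟩
    obtain ⟨j, rfl⟩ := ruler_surjective n
    obtain rfl : (reducedWord (ruler j)).1 = l := congrArg Subtype.val hn
    -- This shift brings row `j`, which spells the word from column 0 on, to the origin.
    refine ⟨_, leftShift_mem_orbitClosure (0, -j) _, fun m hm => ?_⟩
    rw [← edgeColor_natCast hm]
    simp [leftShift, config, symbolDecode_code, layers]

theorem continuous_config : Continuous config := by
  refine continuous_pi fun t => ?_
  exact (continuous_of_discreteTopology (f := fun b : Bool => symbolCode
    (edgeColor (ruler t.2) t.1, rulerParity t.1, rulerParity t.2, b))).comp (continuous_apply _)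

theorem mainTheorem10 :
    ¬ IsSmooth ((topologicalConjugacy (ℤ × ℤ) (Fin 36)).comap
      (Subtype.val : NAToepSubsh (ℤ × ℤ) (Fin 36) → Subshift (Fin 36) (ℤ × ℤ))) := by
  refine not_isSmooth_of_eventuallyEq
    (f := fun z => ⟨orbitClosure (config z), orbitClosure_config_mem z⟩)
    (measurable_orbitClosure continuous_config).subtype_mk (fun z z' h => ?_) fun z => ?_
  · refine topologicalConjugacy_orbitClosure (locallyDetermines_config h)
      (locallyDetermines_config ?_)
    simpa only [ne_comm] using h
  · exact (countable_conjugacyClass (orbitClosure (config z))).preimage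
      orbitClosure_config_injective

end
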